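/- All graphs are finite, simple and undirected; colourings need not be proper. A path in an edge-coloured (respectively vertex-coloured) graph is called \emph{conflict-free} if some colour is used on exactly one of its edges (respectively vertices). For a connected graph $G$, let $\mathrm{cfc}(G)$ (respectively $\mathrm{vcfc}(G)$) be the smallest number of colours in an edge-colouring (respectively vertex-colouring) of $G$ such that every two distinct vertices of $G$ are joined by a conflict-free path. Let $C(G)$ be the subgraph of $G$ induced by the set of its cut-edges, i.e. the subgraph whose edges are the cut-edges of $G$ and whose vertices are their ends, and let $$h(G)=\max\{\mathrm{cfc}(T) : T \text{ is a connected component of } C(G)\},$$ with $h(G)=0$ if $G$ has no cut-edge. \textbf{Theorem.} For every connected graph $G$ of diameter $2$, $$\mathrm{vcfc}(G)=2 \qquad\text{and}\qquad \mathrm{cfc}(G)=\max\{2,h(G)\}.$$ -/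

import Mathlib

namespace ConflictFree

open SimpleGraph

/-- A walk in an edge-coloured graph is conflict-free if some colour is used on exactly one of
its edges. -/
def IsEdgeConflictFree {V K : Type*} {G : SimpleGraph V} (c : G.EdgeLabeling K) {u v : V}
    (p : G.Walk u v) : Prop :=
  ∃ a : K, ∃! e : G.edgeSet, (e : Sym2 V) ∈ p.edges ∧ c e = a

/-- An edge-colouring (adjacent edges may share a colour) makes `G` conflict-free connected if
any two distinct vertices are joined by a conflict-free path. -/
def IsEdgeConflictFreeConnected {V K : Type*} {G : SimpleGraph V} (c : G.EdgeLabeling K) : Prop :=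
  ∀ u v : V, u ≠ v → ∃ p : G.Walk u v, p.IsPath ∧ IsEdgeConflictFree c p

/-- The conflict-free connection number `cfc(G)`: the smallest number of colours in an
edge-colouring that makes `G` conflict-free connected. -/
noncomputable def cfc {V : Type*} (G : SimpleGraph V) : ℕ :=
  sInf {k : ℕ | ∃ c : G.EdgeLabeling (Fin k), IsEdgeConflictFreeConnected c}

/-- A walk in a vertex-coloured graph is conflict-free if some colour is used on exactly one of
its vertices. -/
def IsVertexConflictFree {V K : Type*} {G : SimpleGraph V} (c : V → K) {u v : V}
    (p : G.Walk u v) : Prop :=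
  ∃ a : K, ∃! x : V, x ∈ p.support ∧ c x = a

/-- A vertex-colouring (adjacent vertices may share a colour) makes `G` conflict-free
vertex-connected if any two distinct vertices are joined by a conflict-free path. -/
def IsVertexConflictFreeConnected {V K : Type*} (G : SimpleGraph V) (c : V → K) : Prop :=
  ∀ u v : V, u ≠ v → ∃ p : G.Walk u v, p.IsPath ∧ IsVertexConflictFree c p

/-- The conflict-free vertex-connection number `vcfc(G)`: the smallest number of colours in a
vertex-colouring that makes `G` conflict-free vertex-connected. -/
noncomputable def vcfc {V : Type*} (G : SimpleGraph V) : ℕ :=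
  sInf {k : ℕ | ∃ c : V → Fin k, IsVertexConflictFreeConnected G c}

/-- `C(G)`: the subgraph of `G` induced by its cut-edges. Its edges are the cut-edges of `G` and
its vertices are the ends of the cut-edges. Adjacency is required separately because Mathlib's
`IsBridge` does not ask the pair to be an edge. -/
def cutEdgeSubgraph {V : Type*} (G : SimpleGraph V) : G.Subgraph where
  verts := {v | ∃ w, G.Adj v w ∧ G.IsBridge s(v, w)}
  Adj v w := G.Adj v w ∧ G.IsBridge s(v, w)
  adj_sub h := h.1
  edge_vert h := ⟨_, h⟩
  symm := ⟨fun v w h => ⟨h.1.symm, Sym2.eq_swap (a := v) (b := w) ▸ h.2⟩⟩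

/-- `h(G)`: the largest `cfc` of a component of `C(G)`; it is `0` if `G` has no cut-edge. -/
noncomputable def maxCutForestCfc {V : Type*} (G : SimpleGraph V) : ℕ :=
  ⨆ T : (cutEdgeSubgraph G).coe.ConnectedComponent, cfc T.toSimpleGraph

/-- The infimum defining `cfc` is attained for every finite connected graph. -/
theorem exists_cfc_coloring {V : Type*} [Finite V] {G : SimpleGraph V} (hG : G.Connected) :
    ∃ c : G.EdgeLabeling (Fin (cfc G)), IsEdgeConflictFreeConnected c := by
  refine Nat.sInf_mem (s := {k : ℕ | ∃ c : G.EdgeLabeling (Fin k),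
    IsEdgeConflictFreeConnected c}) ⟨Nat.card G.edgeSet, fun e => Finite.equivFin G.edgeSet e, ?_⟩
  intro u v huv
  obtain ⟨p, hp⟩ := (hG.preconnected u v).exists_isPath
  refine ⟨p, hp, ?_⟩
  cases p with
  | nil => exact absurd rfl huv
  | cons h q =>
    refine ⟨Finite.equivFin G.edgeSet ⟨s(u, _), h⟩, ⟨s(u, _), h⟩, ⟨by simp, rfl⟩, ?_⟩
    rintro e ⟨-, he⟩
    exact (Finite.equivFin G.edgeSet).injective he

/-- The infimum defining `vcfc` is attained for every finite connected graph. -/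
theorem exists_vcfc_coloring {V : Type*} [Finite V] {G : SimpleGraph V} (hG : G.Connected) :
    ∃ c : V → Fin (vcfc G), IsVertexConflictFreeConnected G c := by
  refine Nat.sInf_mem (s := {k : ℕ | ∃ c : V → Fin k,
    IsVertexConflictFreeConnected G c}) ⟨Nat.card V, Finite.equivFin V, ?_⟩
  intro u v _
  obtain ⟨p, hp⟩ := (hG.preconnected u v).exists_isPath
  refine ⟨p, hp, Finite.equivFin V u, u, ⟨by simp, rfl⟩, ?_⟩
  rintro x ⟨-, hx⟩
  exact (Finite.equivFin V).injective hx

/-- The supremum defining `h(G)` is over a bounded family for every finite graph. -/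
theorem cfc_le_maxCutForestCfc {V : Type*} [Finite V] (G : SimpleGraph V)
    (T : (cutEdgeSubgraph G).coe.ConnectedComponent) :
    cfc T.toSimpleGraph ≤ maxCutForestCfc G :=
  le_ciSup (f := fun T : (cutEdgeSubgraph G).coe.ConnectedComponent => cfc T.toSimpleGraph)
    (Set.finite_range _).bddAbove T

end ConflictFree

/-! Lower bounds: two ends of a path in one colour already break uniqueness for vertices, and
non-adjacent ends do so for edges. Inside a component of C(G) the path between two vertices consists
of bridges, so it is their only path in G (`eq_of_forall_isBridge`); hence a good colouring of G
restricts, and h(G) ≤ cfc(G).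

Upper bounds: by diameter 2, a cut vertex is adjacent to all other vertices. If no vertex dominates,
G has no cut vertex, so any two vertices are joined by a path through a prescribed vertex or edge,
and it suffices to single out one vertex or one edge.

If w dominates, singling out w settles vcfc. For cfc, colour each edge off w with o. Among the
spokes from w to a nontrivial component of G - w, one gets i and the others o; pendant spokes get
distinct colours (`exists_spoke_coloring`). There are enough colours: the pendant spokes lie in one
component of C(G), where any good colouring separates them (`exists_injOn_pendant`). -/

namespace ConflictFree

open SimpleGraph

/-! ### Joining and cutting paths; paths made of bridges -/

section Paths

variable {V : Type*} {G : SimpleGraph V}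

theorem isPath_append {u v w : V} {p : G.Walk u v} {q : G.Walk v w} (hp : p.IsPath)
    (hq : q.IsPath) (h : ∀ t ∈ p.support, t ∈ q.support → t = v) : (p.append q).IsPath := by
  induction p with
  | nil => simpa using hq
  | @cons a b c hab p ih =>
    rw [Walk.cons_isPath_iff] at hp
    rw [Walk.cons_append, Walk.cons_isPath_iff]
    refine ⟨ih hp.1 hq fun t ht => h t (by simp [ht]), fun ha => ?_⟩
    rcases (Walk.mem_support_append_iff _ _).1 ha with ha | ha
    · exact hp.2 ha
    · have := h a (by simp) ha
      subst this
      exact hp.2 (by simp)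

/-- Two disjoint paths whose last vertices are adjacent join up to a path through that edge. -/
theorem exists_isPath_mem_edges {x y a b : V} {p : G.Walk x b} {q : G.Walk y a} (hp : p.IsPath)
    (hq : q.IsPath) (h : ∀ t ∈ p.support, t ∉ q.support) (hab : G.Adj a b) :
    ∃ r : G.Walk x y, r.IsPath ∧ s(a, b) ∈ r.edges := by
  refine ⟨p.append (.cons hab.symm q.reverse), isPath_append hp ?_ ?_, by simp [Sym2.eq_swap]⟩
  · exact (Walk.cons_isPath_iff _ _).2 ⟨hq.reverse, by simpa using h b (by simp)⟩
  · intro t ht ht'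
    simp only [Walk.support_cons, Walk.support_reverse, List.mem_cons, List.mem_reverse] at ht'
    exact ht'.resolve_right (h t ht)

/-- A path from `x` to `z` avoids `y`, or contains a path from `y` to `z` avoiding `x`. -/
theorem avoids_or_exists_isPath {x y z : V} {p : G.Walk x z} (hp : p.IsPath) (hxy : x ≠ y) :
    y ∉ p.support ∨
      ∃ q : G.Walk y z, q.IsPath ∧ x ∉ q.support ∧ q.support ⊆ p.support := by
  classical
  refine or_iff_not_imp_left.2 fun hy => ?_
  rw [not_not] at hy
  refine ⟨p.dropUntil y hy, hp.dropUntil hy, fun hx => ?_, p.support_dropUntil_subset_support hy⟩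
  have hs := p.take_spec hy
  rw [← hs] at hp
  exact hp.ne_of_mem_support_of_append hxy (by simp) hx rfl

/-- A walk that ends in a set contains a path to its first vertex in that set. -/
theorem exists_isPath_first_mem {b x : V} (p : G.Walk b x) (S : Set V) (hx : x ∈ S) :
    ∃ q ∈ S, ∃ r : G.Walk b q, r.IsPath ∧ r.support ⊆ p.support ∧
      ∀ t ∈ r.support, t ∈ S → t = q := by
  classical
  induction p with
  | nil => exact ⟨_, hx, .nil, by simp, by simp, by simp⟩
  | @cons a b c hab p ih =>
    by_cases ha : a ∈ S
    · exact ⟨a, ha, .nil, by simp, by simp, by simp⟩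
    · obtain ⟨q, hq, r, -, hrp, hrS⟩ := ih hx
      have hsub := (Walk.cons hab r).support_bypass_subset_support
      refine ⟨q, hq, (Walk.cons hab r).bypass, Walk.bypass_isPath _, fun t ht => ?_,
        fun t ht htS => ?_⟩
      · have := hsub ht
        simp only [Walk.support_cons, List.mem_cons] at this ⊢
        exact this.imp_right fun h => hrp h
      · have := hsub ht
        simp only [Walk.support_cons, List.mem_cons] at this
        rcases this with rfl | h
        · exact absurd htS ha
        · exact hrS t h htS

/-- `G.deleteIncidenceSet w` keeps `w` as an isolated vertex and stands in for G - w. The last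
conjunct keeps the path clear of the other components. -/
theorem exists_isPath_notMem_of_reachable {w x y : V} (hx : x ≠ w)
    (h : (G.deleteIncidenceSet w).Reachable x y) :
    ∃ p : G.Walk x y, p.IsPath ∧ w ∉ p.support ∧
      ∀ t ∈ p.support, (G.deleteIncidenceSet w).Reachable x t := by
  classical
  obtain ⟨p, hp⟩ := h.exists_isPath
  refine ⟨p.mapLe (G.deleteIncidenceSet_le w), hp.mapLe _, ?_, ?_⟩
  · rw [Walk.support_mapLe_eq_support]
    clear hp h
    induction p with
    | nil => simpa using hx.symm
    | cons h p ih =>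
      rw [deleteIncidenceSet_adj] at h
      simpa [hx.symm] using ih h.2.2
  · intro t ht
    rw [Walk.support_mapLe_eq_support] at ht
    exact ⟨p.takeUntil t ht⟩

/-- A path all of whose edges are bridges is the only path between its ends. -/
theorem eq_of_forall_isBridge {x y : V} {p q : G.Walk x y} (hp : p.IsPath) (hq : q.IsPath)
    (hb : ∀ e ∈ q.edges, G.IsBridge e) : p = q := by
  induction q with
  | nil => exact (Walk.isPath_iff_nil.1 hp).eq_nil
  | @cons x a y hxa q ih =>
    rw [Walk.cons_isPath_iff] at hq
    have hnot : s(x, a) ∉ q.edges := fun h => hq.2 (q.fst_mem_support_of_mem_edges h)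
    -- The walk along `p` and back along `q` from `x` to `a` must cross this bridge, and `q` does
    -- not.
    have hmem : s(x, a) ∈ p.edges := by
      have := isBridge_iff_forall_walk_mem_edges.1 (hb s(x, a) (by simp)) (p.append q.reverse)
      simpa [hnot] using this
    cases p with
    | nil => simp at hmem
    | @cons _ b _ hxb p =>
      rw [Walk.cons_isPath_iff] at hp
      rw [Walk.edges_cons, List.mem_cons] at hmem
      rcases hmem with h | h
      · obtain rfl : a = b := by simpa [hxb.ne] using h
        rw [ih hp.1 hq.1 fun e he => hb e (by simp [he])]
      · exact absurd (p.fst_mem_support_of_mem_edges h) hp.2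

end Paths

/-! ### Conflict-free colourings: lower bounds and singling out one element -/

section Colorings

variable {V K : Type*} {G : SimpleGraph V}

theorem isEdgeConflictFree_of_mem {c : G.EdgeLabeling K} {u v : V} {p : G.Walk u v} (e : G.edgeSet)
    (he : (e : Sym2 V) ∈ p.edges) (h : ∀ e' : G.edgeSet, (e' : Sym2 V) ∈ p.edges → c e' = c e →
      e' = e) : IsEdgeConflictFree c p :=
  ⟨c e, e, ⟨he, rfl⟩, fun e' h' => h e' h'.1 h'.2⟩

theorem isEdgeConflictFree_reverse {c : G.EdgeLabeling K} {u v : V} {p : G.Walk u v} :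
    IsEdgeConflictFree c p.reverse ↔ IsEdgeConflictFree c p := by
  simp [IsEdgeConflictFree]

theorem exists_isPath_isEdgeConflictFree_of_adj (c : G.EdgeLabeling K) {u v : V}
    (h : G.Adj u v) : ∃ p : G.Walk u v, p.IsPath ∧ IsEdgeConflictFree c p := by
  refine ⟨h.toWalk, by simp [h.ne], isEdgeConflictFree_of_mem ⟨s(u, v), h⟩ (by simp) ?_⟩
  intro e he _
  exact Subtype.ext (by simpa using he)

/-- Paths between non-adjacent vertices need two edge colours. -/
theorem nontrivial_of_isEdgeConflictFreeConnected {c : G.EdgeLabeling K}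
    (hc : IsEdgeConflictFreeConnected c) {u v : V} (huv : u ≠ v) (h : ¬ G.Adj u v) :
    Nontrivial K := by
  by_contra hK
  rw [not_nontrivial_iff_subsingleton] at hK
  obtain ⟨p, hp, a, e, -, he⟩ := hc u v huv
  cases p with
  | nil => exact huv rfl
  | cons h₁ p =>
    cases p with
    | nil => exact h h₁
    | @cons _ x _ h₂ p =>
      have e₁ := he ⟨s(_, _), h₁⟩ ⟨by simp, Subsingleton.elim _ _⟩
      have e₂ := he ⟨s(_, _), h₂⟩ ⟨by simp, Subsingleton.elim _ _⟩
      have := congrArg Subtype.val (e₁.trans e₂.symm)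
      rw [Walk.cons_isPath_iff] at hp
      have hx : u ≠ x := fun h => hp.2 (by simp [h])
      simp only [Sym2.eq_iff] at this
      rcases this with ⟨h, -⟩ | ⟨h, -⟩
      · exact h₁.ne h
      · exact hx h

/-- Adjacent vertices need two vertex colours. -/
theorem nontrivial_of_isVertexConflictFreeConnected {c : V → K}
    (hc : IsVertexConflictFreeConnected G c) {u v : V} (huv : u ≠ v) : Nontrivial K := by
  by_contra hK
  rw [not_nontrivial_iff_subsingleton] at hK
  obtain ⟨p, hp, a, x, -, hx⟩ := hc u v huv
  exact huv ((hx u ⟨by simp, Subsingleton.elim _ _⟩).trans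
    (hx v ⟨by simp, Subsingleton.elim _ _⟩).symm)

/-- If every two vertices are joined by a path through `a`, it suffices to single out `a`. -/
theorem isVertexConflictFreeConnected_of_forall_mem [DecidableEq V] {o i : K} (hoi : o ≠ i) (a : V)
    (h : ∀ x y, x ≠ y → ∃ p : G.Walk x y, p.IsPath ∧ a ∈ p.support) :
    IsVertexConflictFreeConnected G (fun x => if x = a then i else o) := by
  intro x y hxy
  obtain ⟨p, hp, ha⟩ := h x y hxy
  refine ⟨p, hp, i, a, ⟨ha, by simp⟩, fun t ht => ?_⟩
  by_contra hta
  exact hoi (by simpa [hta] using ht.2)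

/-- If every two vertices are joined by a path through the edge `e`, it suffices to single
out `e`. -/
theorem exists_isEdgeConflictFreeConnected_of_forall_mem {o i : K} (hoi : o ≠ i) {e : Sym2 V}
    (he : e ∈ G.edgeSet) (h : ∀ x y, x ≠ y → ∃ p : G.Walk x y, p.IsPath ∧ e ∈ p.edges) :
    ∃ c : G.EdgeLabeling K, IsEdgeConflictFreeConnected c := by
  classical
  let c : G.EdgeLabeling K := fun e' => if e'.1 = e then i else o
  refine ⟨c, fun x y hxy => ?_⟩
  obtain ⟨p, hp, hep⟩ := h x y hxy
  refine ⟨p, hp, isEdgeConflictFree_of_mem ⟨e, he⟩ hep fun e' _ h' => ?_⟩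
  by_contra hne
  have : e'.1 ≠ e := fun h => hne (Subtype.ext h)
  exact hoi (by simpa [c, this] using h')

end Colorings

/-! ### No dominating vertex: paths through a prescribed vertex or edge -/

section NoDominatingVertex

variable {V : Type*} {G : SimpleGraph V}

/-- In a graph of diameter at most two, a vertex whose removal disconnects the rest is adjacent to
all other vertices. -/
theorem reachable_deleteIncidenceSet
    (hd : ∀ x y, x ≠ y → ¬ G.Adj x y → ∃ m, G.Adj x m ∧ G.Adj m y)
    {a : V} (ha : ¬ ∀ x, x ≠ a → G.Adj a x) {x y : V} (hx : x ≠ a) (hy : y ≠ a) :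
    (G.deleteIncidenceSet a).Reachable x y := by
  by_contra hxy
  refine ha fun t ht => ?_
  -- A common neighbour of `s` and `t` can only be `a`. Since `a` separates `x` from `y`, every `t`
  -- is separated from one of them.
  have key : ∀ s, s ≠ a → ¬ (G.deleteIncidenceSet a).Reachable s t → G.Adj a t := by
    intro s hs hst
    have hne : s ≠ t := fun h => hst (h ▸ Reachable.refl _)
    have hnadj : ¬ G.Adj s t := fun h =>
      hst (deleteIncidenceSet_adj.2 ⟨h, hs, ht⟩ : (G.deleteIncidenceSet a).Adj s t).reachable
    obtain ⟨m, hsm, hmt⟩ := hd s t hne hnadj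
    by_cases hma : m = a
    · exact hma ▸ hmt
    · exact absurd ((deleteIncidenceSet_adj.2 ⟨hsm, hs, hma⟩ :
        (G.deleteIncidenceSet a).Adj s m).reachable.trans
          (deleteIncidenceSet_adj.2 ⟨hmt, hma, ht⟩ :
            (G.deleteIncidenceSet a).Adj m t).reachable) hst
  by_cases hxt : (G.deleteIncidenceSet a).Reachable x t
  · exact key y hy fun hyt => hxy (hxt.trans hyt.symm)
  · exact key x hx hxt

/-- In a graph of diameter at most two without cut vertices, any two vertices are joined to a third
one by paths that meet only there. -/
theorem exists_isPath_pair
    (hd : ∀ x y, x ≠ y → ¬ G.Adj x y → ∃ m, G.Adj x m ∧ G.Adj m y)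
    (hc : ∀ a x y, x ≠ a → y ≠ a → (G.deleteIncidenceSet a).Reachable x y)
    {a x y : V} (hxy : x ≠ y) (hx : x ≠ a) (hy : y ≠ a) :
    ∃ (p : G.Walk x a) (q : G.Walk y a), p.IsPath ∧ q.IsPath ∧
      ∀ t ∈ p.support, t ∈ q.support → t = a := by
  have adj : ∀ x y, x ≠ y → x ≠ a → y ≠ a → G.Adj x a →
      ∃ (p : G.Walk x a) (q : G.Walk y a), p.IsPath ∧ q.IsPath ∧
        ∀ t ∈ p.support, t ∈ q.support → t = a := by
    intro x y hxy hx hy h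
    obtain ⟨q, hq, hxq, -⟩ := exists_isPath_notMem_of_reachable hxy.symm (hc x y a hxy.symm hx.symm)
    refine ⟨h.toWalk, q, by simp [hx], hq, fun t ht htq => ?_⟩
    have : t = x ∨ t = a := by simpa using ht
    exact this.resolve_left fun h => hxq (h ▸ htq)
  have two : ∀ x y m, x ≠ y → x ≠ a → y ≠ a → G.Adj y m → G.Adj m a →
      (∃ p : G.Walk x a, p.IsPath ∧ y ∉ p.support ∧ m ∉ p.support) →
      ∃ (p : G.Walk x a) (q : G.Walk y a), p.IsPath ∧ q.IsPath ∧
        ∀ t ∈ p.support, t ∈ q.support → t = a := by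
    rintro x y m hxy hx hy hym hma ⟨p, hp, hyp, hmp⟩
    refine ⟨p, .cons hym hma.toWalk, hp, by simp [hym.ne, hy, hma.ne], fun t ht htq => ?_⟩
    have : t = y ∨ t = m ∨ t = a := by simpa using htq
    rcases this with rfl | rfl | h
    · exact absurd ht hyp
    · exact absurd ht hmp
    · exact h
  have swap : (∃ (p : G.Walk y a) (q : G.Walk x a), p.IsPath ∧ q.IsPath ∧
        ∀ t ∈ p.support, t ∈ q.support → t = a) →
      ∃ (p : G.Walk x a) (q : G.Walk y a), p.IsPath ∧ q.IsPath ∧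
        ∀ t ∈ p.support, t ∈ q.support → t = a :=
    fun ⟨p, q, hp, hq, h⟩ => ⟨q, p, hq, hp, fun t ht ht' => h t ht' ht⟩
  by_cases hxa : G.Adj x a
  · exact adj x y hxy hx hy hxa
  by_cases hya : G.Adj y a
  · exact swap (adj y x hxy.symm hy hx hya)
  obtain ⟨m, hxm, hma⟩ := hd x a hx hxa
  obtain ⟨n, hyn, hna⟩ := hd y a hy hya
  have hxn : x ≠ n := fun h => hxa (h ▸ hna)
  have hxm' : x ≠ m := hxm.ne
  have hym : y ≠ m := fun h => hya (h ▸ hma)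
  -- With a shared midpoint, a path from `x` to `a` avoiding it serves one of the two vertices, and
  -- the other goes through the midpoint. Distinct midpoints give two disjoint routes of length two.
  by_cases hmn : m = n
  · subst hmn
    obtain ⟨p, hp, hmp, -⟩ := exists_isPath_notMem_of_reachable hxn (hc m x a hxn hma.ne')
    rcases avoids_or_exists_isPath hp hxy with h | ⟨q, hq, hxq, hqp⟩
    · exact two x y m hxy hx hy hyn hma ⟨p, hp, h, hmp⟩
    · exact swap (two y x m hxy.symm hy hx hxm hma ⟨q, hq, hxq, fun h => hmp (hqp h)⟩)
  · refine two x y n hxy hx hy hyn hna ⟨.cons hxm hma.toWalk, by simp [hxm', hx, hma.ne], ?_, ?_⟩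
    · simp [hxy.symm, hym, hy]
    · simp [hxn.symm, Ne.symm hmn, hna.ne]

/-- In a graph of diameter at most two without cut vertices, any two vertices are joined by a path
through any given vertex. -/
theorem exists_isPath_mem_support
    (hd : ∀ x y, x ≠ y → ¬ G.Adj x y → ∃ m, G.Adj x m ∧ G.Adj m y)
    (hc : ∀ a x y, x ≠ a → y ≠ a → (G.deleteIncidenceSet a).Reachable x y)
    (hconn : G.Connected) (a : V) {x y : V} (hxy : x ≠ y) :
    ∃ p : G.Walk x y, p.IsPath ∧ a ∈ p.support := by
  obtain ⟨r, hr⟩ := hconn.exists_isPath x y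
  by_cases hx : x = a
  · exact ⟨r, hr, by simp [← hx]⟩
  by_cases hy : y = a
  · exact ⟨r, hr, by simp [← hy]⟩
  obtain ⟨p, q, hp, hq, h⟩ := exists_isPath_pair hd hc hxy hx hy
  exact ⟨p.append q.reverse, isPath_append hp hq.reverse (by simpa using h), by simp⟩

/-- In a graph of diameter at most two without cut vertices, any two vertices are joined by a path
through any given edge. -/
theorem exists_isPath_mem_edges_of_adj
    (hd : ∀ x y, x ≠ y → ¬ G.Adj x y → ∃ m, G.Adj x m ∧ G.Adj m y)
    (hc : ∀ a x y, x ≠ a → y ≠ a → (G.deleteIncidenceSet a).Reachable x y)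
    {a b : V} (hab : G.Adj a b) {x y : V} (hxy : x ≠ y) :
    ∃ p : G.Walk x y, p.IsPath ∧ s(a, b) ∈ p.edges := by
  classical
  have swap : ∀ x y, (∃ p : G.Walk y x, p.IsPath ∧ s(a, b) ∈ p.edges) →
      ∃ p : G.Walk x y, p.IsPath ∧ s(a, b) ∈ p.edges :=
    fun x y ⟨p, hp, h⟩ => ⟨p.reverse, hp.reverse, by simpa using h⟩
  have start : ∀ y, a ≠ y → ∃ p : G.Walk a y, p.IsPath ∧ s(a, b) ∈ p.edges := by
    intro y hy
    obtain ⟨p, hp, hap, -⟩ :=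
      exists_isPath_notMem_of_reachable hab.ne' (hc a b y hab.ne' hy.symm)
    exact ⟨.cons hab p, (Walk.cons_isPath_iff _ _).2 ⟨hp, hap⟩, by simp⟩
  -- The new path follows `p` from `x` to `z`, then `r` backwards to `b`, the edge to `a`, and `q`
  -- backwards to `y`.
  have attach : ∀ x y, ∀ (p : G.Walk x a) (q : G.Walk y a), p.IsPath → q.IsPath →
      (∀ t ∈ p.support, t ∈ q.support → t = a) →
      ∀ z ∈ p.support, ∀ r : G.Walk b z, r.IsPath → a ∉ r.support →
      (∀ t ∈ r.support, t ∈ p.support ∨ t ∈ q.support → t = z) →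
      ∃ p : G.Walk x y, p.IsPath ∧ s(a, b) ∈ p.edges := by
    intro x y p q hp hq hpq z hz r hr har hrS
    have hza : z ≠ a := fun h => har (h ▸ r.end_mem_support)
    have hzp := p.support_takeUntil_subset_support hz
    refine exists_isPath_mem_edges
      (isPath_append (hp.takeUntil hz) hr.reverse fun t ht ht' => ?_) hq ?_ hab
    · exact hrS t (by simpa using ht') (.inl (hzp ht))
    · intro t ht htq
      rcases (Walk.mem_support_append_iff _ _).1 ht with ht | ht
      · have hta := hpq t (hzp ht) htq
        subst hta
        exact Walk.endpoint_notMem_support_takeUntil hp hz hza.symm ht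
      · have htz := hrS t (by simpa using ht) (.inr htq)
        subst htz
        exact hza (hpq t hz htq)
  by_cases hx : x = a
  · subst hx; exact start y hxy
  by_cases hy : y = a
  · subst hy; exact swap x y (start x hxy.symm)
  obtain ⟨p, q, hp, hq, h⟩ := exists_isPath_pair hd hc hxy hx hy
  obtain ⟨r, hr, har, -⟩ := exists_isPath_notMem_of_reachable hab.ne' (hc a b x hab.ne' hx)
  obtain ⟨z, hz, s, hs, hsr, hsS⟩ :=
    exists_isPath_first_mem r {t | t ∈ p.support ∨ t ∈ q.support} (by simp)
  rcases hz with hz | hz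
  · exact attach x y p q hp hq h z hz s hs (fun h => har (hsr h)) hsS
  · exact swap x y (attach y x q p hq hp (fun t ht ht' => h t ht' ht) z hz s hs
      (fun h => har (hsr h)) fun t ht ht' => hsS t ht ht'.symm)

end NoDominatingVertex

/-! ### A dominating vertex: colouring the spokes -/

section DominatingVertex

variable {V K : Type*} {G : SimpleGraph V}

/-- If a vertex `w` is adjacent to all others, two vertices are joined by a path through `w`. -/
theorem exists_isPath_mem_support_of_forall_adj {w : V} (hw : ∀ x, x ≠ w → G.Adj w x) {x y : V}
    (hxy : x ≠ y) : ∃ p : G.Walk x y, p.IsPath ∧ w ∈ p.support := by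
  by_cases hx : x = w
  · subst hx
    exact ⟨(hw y hxy.symm).toWalk, by simp [hxy], by simp⟩
  by_cases hy : y = w
  · subst hy
    exact ⟨(hw x hxy).symm.toWalk, by simp [hxy], by simp⟩
  · exact ⟨.cons (hw x hx).symm (hw y hy).toWalk, by simp [hxy, hx, Ne.symm hy], by simp⟩

/-- Colour the edges at `w` by `f` and all others by `o`. A path from `x` to `u` extends through
`w` to a conflict-free path ending in `y`, provided `f u ≠ f y`. -/
theorem exists_isEdgeConflictFree_through {o : K} {w : V} (hw : ∀ x, x ≠ w → G.Adj w x)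
    {f : V → K} {c : G.EdgeLabeling K} (hcw : ∀ x (h : G.Adj w x), c ⟨s(w, x), h⟩ = f x)
    (hco : ∀ e : G.edgeSet, w ∉ (e : Sym2 V) → c e = o) {x y u : V} (hy : y ≠ w) {p : G.Walk x u}
    (hp : p.IsPath) (hwp : w ∉ p.support) (hyp : y ∉ p.support) (hf : f u ≠ f y) :
    ∃ p : G.Walk x y, p.IsPath ∧ IsEdgeConflictFree c p := by
  have hu : u ≠ w := fun h => hwp (h ▸ p.end_mem_support)
  have hwu : G.Adj w u := hw u hu
  have hwy : G.Adj w y := hw y hy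
  have hpo : ∀ e : G.edgeSet, (e : Sym2 V) ∈ p.edges → c e = o := fun e he =>
    hco e fun hwe => hwp (p.mem_support_of_mem_edges he hwe)
  have hedges : ((p.concat hwu.symm).concat hwy).edges = p.edges ++ [s(u, w), s(w, y)] := by
    simp
  refine ⟨(p.concat hwu.symm).concat hwy, (hp.concat hwp hwu.symm).concat ?_ hwy, ?_⟩
  · simp [Walk.support_concat, hyp, hy]
  have hmem : ∀ e : G.edgeSet, (e : Sym2 V) ∈ ((p.concat hwu.symm).concat hwy).edges →
      c e = o ∨ e = ⟨s(w, u), hwu⟩ ∨ e = ⟨s(w, y), hwy⟩ := by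
    intro e he
    rw [hedges, List.mem_append] at he
    rcases he with he | he
    · exact .inl (hpo e he)
    · right
      simpa [Subtype.ext_iff, Sym2.eq_swap (a := u)] using he
  -- Before the two spokes only `o` occurs, so the spoke to `y` is unique in its colour if `f u =
  -- o`, and the spoke to `u` otherwise.
  by_cases hfu : f u = o
  · refine isEdgeConflictFree_of_mem ⟨s(w, y), hwy⟩ (by simp [hedges]) fun e he h => ?_
    rw [hcw] at h
    rcases hmem e he with h' | rfl | rfl
    · exact absurd (hfu.trans (h'.symm.trans h)) hf
    · exact absurd ((hcw _ _).symm.trans h) hf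
    · rfl
  · refine isEdgeConflictFree_of_mem ⟨s(w, u), hwu⟩ (by simp [hedges, Sym2.eq_swap (a := u)])
      fun e he h => ?_
    rw [hcw] at h
    rcases hmem e he with h' | rfl | rfl
    · exact absurd (h.symm.trans h') hfu
    · rfl
    · exact absurd (h.symm.trans (hcw _ _)) hf

/-- The spokes at a dominating vertex `w` can be coloured so that pendant ones get prescribed
colours, and in each other component of `G - w` exactly one vertex gets colour `i` and
the rest gets colour `o`. -/
theorem exists_spoke_coloring {o i : K} (w : V) (g : V → K) :
    ∃ f : V → K, (∀ x, x ≠ w → (∀ y, G.Adj x y → y = w) → f x = g x) ∧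
      ∀ x, x ≠ w → (∃ y, G.Adj x y ∧ y ≠ w) →
        ∃ z, (G.deleteIncidenceSet w).Reachable x z ∧ f z = i ∧
          ∀ t, (G.deleteIncidenceSet w).Reachable x t → t ≠ z → f t = o := by
  classical
  let H := G.deleteIncidenceSet w
  let rep : V → V := fun x => (H.connectedComponentMk x).out
  have hrep : ∀ x, H.Reachable x (rep x) := fun x =>
    (ConnectedComponent.exact (Quot.out_eq (H.connectedComponentMk x))).symm
  refine ⟨fun x => if x ≠ w ∧ ∀ y, G.Adj x y → y = w then g x else if rep x = x then i else o,
    fun x hx h => if_pos ⟨hx, h⟩, fun x hx h => ?_⟩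
  have hleaf : ∀ t, H.Reachable x t → ¬ (t ≠ w ∧ ∀ y, G.Adj t y → y = w) := by
    rintro t hxt ⟨-, ht⟩
    by_cases hne : t = x
    · obtain ⟨y, hxy, hy⟩ := h
      exact hy (ht y (hne ▸ hxy))
    · obtain ⟨p⟩ := hxt.symm
      cases p with
      | nil => exact hne rfl
      | cons h _ =>
        rw [deleteIncidenceSet_adj] at h
        exact h.2.2 (ht _ h.1)
  have heq : ∀ t, H.Reachable x t → rep t = rep x := fun t ht => by
    simp only [rep, ConnectedComponent.sound ht]
  refine ⟨rep x, hrep x, ?_, fun t ht htz => ?_⟩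
  · simp only [if_neg (hleaf _ (hrep x)), if_pos (heq _ (hrep x))]
  · simp only [if_neg (hleaf t ht), if_neg (heq t ht ▸ htz.symm : ¬ rep t = t)]

theorem exists_isEdgeConflictFreeConnected_of_forall_adj {o i : K} (hoi : o ≠ i) {w : V}
    (hw : ∀ x, x ≠ w → G.Adj w x) {g : V → K}
    (hg : Set.InjOn g {x | x ≠ w ∧ ∀ y, G.Adj x y → y = w}) :
    ∃ c : G.EdgeLabeling K, IsEdgeConflictFreeConnected c := by
  classical
  obtain ⟨f, hfg, hf⟩ := exists_spoke_coloring (G := G) (o := o) (i := i) w g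
  let c : G.EdgeLabeling K := fun e => if h : w ∈ (e : Sym2 V) then f (Sym2.Mem.other h) else o
  have hcw : ∀ x (h : G.Adj w x), c ⟨s(w, x), h⟩ = f x := by
    intro x h
    have hm : w ∈ s(w, x) := by simp
    have : Sym2.Mem.other hm = x := Sym2.congr_right.1 (Sym2.other_spec hm)
    simp only [c, dif_pos hm, this]
  have hco : ∀ e : G.edgeSet, w ∉ (e : Sym2 V) → c e = o := fun e he => dif_neg he
  refine ⟨c, ?_⟩
  have swap : ∀ x y, (∃ p : G.Walk y x, p.IsPath ∧ IsEdgeConflictFree c p) →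
      ∃ p : G.Walk x y, p.IsPath ∧ IsEdgeConflictFree c p :=
    fun x y ⟨p, hp, h⟩ => ⟨p.reverse, hp.reverse, isEdgeConflictFree_reverse.2 h⟩
  have apart : ∀ x y, x ≠ w → y ≠ w → ¬ (G.deleteIncidenceSet w).Reachable x y →
      (∃ t, G.Adj x t ∧ t ≠ w) → f x = f y →
      ∃ p : G.Walk x y, p.IsPath ∧ IsEdgeConflictFree c p := by
    intro x y hx hy hxy hxt hfxy
    -- A nontrivial component uses both `i` and `o` on its spokes.
    obtain ⟨u, hxu, hfu⟩ : ∃ u, (G.deleteIncidenceSet w).Reachable x u ∧ f u ≠ f x := by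
      obtain ⟨z, hxz, hfz, hz⟩ := hf x hx hxt
      by_cases h : x = z
      · obtain ⟨t, hadj, ht⟩ := hxt
        have hr : (G.deleteIncidenceSet w).Reachable x t :=
          (deleteIncidenceSet_adj.2 ⟨hadj, hx, ht⟩ : (G.deleteIncidenceSet w).Adj x t).reachable
        refine ⟨t, hr, ?_⟩
        rw [hz t hr (h ▸ hadj.ne'), h, hfz]
        exact hoi
      · refine ⟨z, hxz, ?_⟩
        rw [hfz, hz x (Reachable.refl _) h]
        exact hoi.symm
    obtain ⟨p, hp, hwp, hpr⟩ := exists_isPath_notMem_of_reachable hx hxu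
    exact exists_isEdgeConflictFree_through hw hcw hco hy hp hwp (fun h => hxy (hpr y h))
      (hfxy ▸ hfu)
  intro x y hxy
  by_cases hx : x = w
  · exact exists_isPath_isEdgeConflictFree_of_adj c (hx ▸ hw y (hx ▸ hxy.symm))
  by_cases hy : y = w
  · exact exists_isPath_isEdgeConflictFree_of_adj c (hy ▸ (hw x hx).symm)
  by_cases hfxy : f x = f y
  · by_cases hr : (G.deleteIncidenceSet w).Reachable x y
    · obtain ⟨z, hxz, hfz, hz⟩ := hf x hx (by
        obtain ⟨p⟩ := hr
        cases p with
        | nil => exact absurd rfl hxy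
        | cons h _ =>
          rw [deleteIncidenceSet_adj] at h
          exact ⟨_, h.1, h.2.2⟩)
      -- Only one spoke of the component has colour `i`, so two equal colours are both `o`.
      have hfx : f x = o := by
        by_cases h : x = z
        · rw [hfxy]
          exact hz y hr (h ▸ hxy.symm)
        · exact hz x (Reachable.refl _) h
      obtain ⟨p, hp, hwp, -⟩ := exists_isPath_notMem_of_reachable hx hxz
      rcases avoids_or_exists_isPath hp hxy with h | ⟨q, hq, hxq, hqp⟩
      · refine exists_isEdgeConflictFree_through hw hcw hco hy hp hwp h ?_
        rw [hfz, ← hfxy, hfx]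
        exact hoi.symm
      · refine swap x y (exists_isEdgeConflictFree_through hw hcw hco hx hq
          (fun h => hwp (hqp h)) hxq ?_)
        rw [hfz, hfx]
        exact hoi.symm
    · by_cases hxt : ∃ t, G.Adj x t ∧ t ≠ w
      · exact apart x y hx hy hr hxt hfxy
      by_cases hyt : ∃ t, G.Adj y t ∧ t ≠ w
      · exact swap x y (apart y x hy hx (fun h => hr h.symm) hyt hfxy.symm)
      push Not at hxt hyt
      rw [hfg x hx hxt, hfg y hy hyt] at hfxy
      exact absurd (hg ⟨hx, hxt⟩ ⟨hy, hyt⟩ hfxy) hxy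
  · exact exists_isEdgeConflictFree_through hw hcw hco hy (p := .nil) (by simp)
      (by simpa using Ne.symm hx) (by simpa using hxy.symm) hfxy

end DominatingVertex

/-! ### Components of C(G): restriction and pendant edges -/

section Components

variable {V W K : Type*} {G : SimpleGraph V}

theorem isEdgeConflictFree_of_map {H : SimpleGraph W} (f : H →g G) (hf : Function.Injective f)
    {c : G.EdgeLabeling K} {u v : W} {p : H.Walk u v} (h : IsEdgeConflictFree c (p.map f)) :
    IsEdgeConflictFree (c.pullback f) p := by
  obtain ⟨a, e, ⟨he, hea⟩, huniq⟩ := h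
  rw [Walk.edges_map, List.mem_map] at he
  obtain ⟨d, hd, hde⟩ := he
  have hd' := p.edges_subset_edgeSet hd
  obtain rfl : f.mapEdgeSet ⟨d, hd'⟩ = e := Subtype.ext hde
  refine ⟨a, ⟨d, hd'⟩, ⟨hd, hea⟩, fun e' ⟨he', hea'⟩ => ?_⟩
  refine Hom.mapEdgeSet.injective f hf (huniq _ ⟨?_, hea'⟩)
  rw [Walk.edges_map]
  exact List.mem_map_of_mem he'

/-- The inclusion of a component of `C(G)` into `G`. -/
def cutEdgeComponentHom (T : (cutEdgeSubgraph G).coe.ConnectedComponent) : T.toSimpleGraph →g G :=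
  (cutEdgeSubgraph G).hom.comp T.toSimpleGraph_hom

theorem cutEdgeComponentHom_injective (T : (cutEdgeSubgraph G).coe.ConnectedComponent) :
    Function.Injective (cutEdgeComponentHom T) :=
  Subtype.val_injective.comp Subtype.val_injective

/-- A colouring that makes `G` conflict-free connected restricts to the components of `C(G)`. -/
theorem cfc_le_of_cutEdgeComponent [Finite V] (hG : G.Connected)
    (T : (cutEdgeSubgraph G).coe.ConnectedComponent) : cfc T.toSimpleGraph ≤ cfc G := by
  obtain ⟨c, hc⟩ := exists_cfc_coloring hG
  refine Nat.sInf_le ⟨c.pullback (cutEdgeComponentHom T), fun u v huv => ?_⟩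
  have hinj := cutEdgeComponentHom_injective T
  obtain ⟨p, hp, hpc⟩ := hc _ _ (hinj.ne huv)
  obtain ⟨q, hq⟩ := T.connected_toSimpleGraph.exists_isPath u v
  refine ⟨q, hq, isEdgeConflictFree_of_map _ hinj ?_⟩
  rwa [← eq_of_forall_isBridge hp (hq.map hinj) ?_]
  intro e he
  rw [Walk.edges_map, List.mem_map] at he
  obtain ⟨d, hd, rfl⟩ := he
  have hd' := q.edges_subset_edgeSet hd
  induction d with
  | _ a b => exact hd'.2

theorem maxCutForestCfc_le_cfc [Finite V] (hG : G.Connected) : maxCutForestCfc G ≤ cfc G :=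
  ciSup_le' (cfc_le_of_cutEdgeComponent hG)

theorem isBridge_of_forall_adj {w x : V} (hxw : x ≠ w) (hx : ∀ t, G.Adj x t → t = w) :
    G.IsBridge s(x, w) := by
  rw [isBridge_iff_forall_walk_mem_edges]
  intro p
  cases p with
  | nil => exact absurd rfl hxw
  | cons h _ => simp [hx _ h]

/-- Two pendant edges at the same vertex must get different colours. -/
theorem ne_of_isEdgeConflictFreeConnected {c : G.EdgeLabeling K}
    (hc : IsEdgeConflictFreeConnected c) {w x y : V} (hxy : x ≠ y) (hwx : G.Adj w x)
    (hwy : G.Adj w y) (hx : ∀ t, G.Adj x t → t = w) (hy : ∀ t, G.Adj y t → t = w) :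
    c ⟨s(w, x), hwx⟩ ≠ c ⟨s(w, y), hwy⟩ := by
  intro heq
  obtain ⟨p, hp, a, e, ⟨he, hea⟩, huniq⟩ := hc x y hxy
  obtain rfl : p = .cons hwx.symm hwy.toWalk := by
    refine eq_of_forall_isBridge hp (by simp [hxy, hwx.ne', hwy.ne]) fun e he => ?_
    have : e = s(x, w) ∨ e = s(w, y) := by simpa using he
    rcases this with rfl | rfl
    · exact isBridge_of_forall_adj hwx.ne' hx
    · exact Sym2.eq_swap (a := y) ▸ isBridge_of_forall_adj hwy.ne' hy
  have hne : (⟨s(w, x), hwx⟩ : G.edgeSet) ≠ ⟨s(w, y), hwy⟩ := fun h =>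
    hxy (Sym2.congr_right.1 (congrArg Subtype.val h))
  have h2 : c ⟨s(w, x), hwx⟩ = a := by
    have : (e : Sym2 V) = s(x, w) ∨ (e : Sym2 V) = s(w, y) := by simpa using he
    rcases this with h | h
    · obtain rfl : e = ⟨s(w, x), hwx⟩ := Subtype.ext (h.trans Sym2.eq_swap)
      exact hea
    · obtain rfl : e = ⟨s(w, y), hwy⟩ := Subtype.ext h
      exact heq.trans hea
  refine hne ((huniq _ ⟨?_, h2⟩).trans (huniq _ ⟨?_, heq.symm.trans h2⟩).symm)
  · simp [Sym2.eq_swap (a := w)]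
  · simp

/-- If `w` is adjacent to all other vertices, the pendant vertices have distinct colours available
among `h(G)` many. -/
theorem exists_injOn_pendant [Finite V] {w : V} (hw : ∀ x, x ≠ w → G.Adj w x) {m : ℕ}
    (hm : maxCutForestCfc G ≤ m) (o : Fin m) :
    ∃ g : V → Fin m, Set.InjOn g {x | x ≠ w ∧ ∀ y, G.Adj x y → y = w} := by
  classical
  by_cases hne : ∃ x, x ≠ w ∧ ∀ y, G.Adj x y → y = w
  swap
  · exact ⟨fun _ => o, fun x hx => absurd ⟨x, hx⟩ hne⟩
  have hcut : ∀ x, x ≠ w → (∀ y, G.Adj x y → y = w) → (cutEdgeSubgraph G).Adj w x :=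
    fun x hx h => ⟨hw x hx, Sym2.eq_swap (a := x) ▸ isBridge_of_forall_adj hx h⟩
  obtain ⟨x₀, hx₀, hx₀'⟩ := hne
  let w' : (cutEdgeSubgraph G).verts := ⟨w, (hcut x₀ hx₀ hx₀').fst_mem⟩
  let T := (cutEdgeSubgraph G).coe.connectedComponentMk w'
  obtain ⟨c, hc⟩ := exists_cfc_coloring T.connected_toSimpleGraph
  let w'' : T := ⟨w', rfl⟩
  -- All pendant edges share the end `w`, so they lie in the single component `T`.
  have key : ∀ x : {x | x ≠ w ∧ ∀ y, G.Adj x y → y = w}, ∃ x' : T, (x' : V) = x ∧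
      T.toSimpleGraph.Adj w'' x' := by
    rintro ⟨x, hx, hx'⟩
    have hadj : (cutEdgeSubgraph G).coe.Adj w' ⟨x, (hcut x hx hx').snd_mem⟩ := hcut x hx hx'
    exact ⟨⟨⟨x, (hcut x hx hx').snd_mem⟩, ConnectedComponent.sound hadj.reachable.symm⟩, rfl, hadj⟩
  choose φ hφ hφadj using key
  refine ⟨fun x => if hx : x ∈ {x | x ≠ w ∧ ∀ y, G.Adj x y → y = w} then
    Fin.castLE ((cfc_le_maxCutForestCfc G T).trans hm) (c ⟨s(w'', φ ⟨x, hx⟩), hφadj _⟩) else o, ?_⟩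
  intro x hx y hy hxy
  by_contra hne
  simp only [dif_pos hx, dif_pos hy] at hxy
  have only : ∀ (x : V) (hx : x ∈ {x | x ≠ w ∧ ∀ y, G.Adj x y → y = w}) t,
      T.toSimpleGraph.Adj (φ ⟨x, hx⟩) t → t = w'' := by
    intro x hx t ht
    refine Subtype.ext (Subtype.ext (hx.2 _ ?_))
    have hadj : G.Adj (φ ⟨x, hx⟩ : V) (t : V) := (cutEdgeComponentHom T).map_adj ht
    rwa [hφ ⟨x, hx⟩] at hadj
  refine ne_of_isEdgeConflictFreeConnected hc ?_ (hφadj ⟨x, hx⟩) (hφadj ⟨y, hy⟩) (only x hx)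
    (only y hy) (Fin.castLE_injective _ hxy)
  intro h
  exact hne ((hφ ⟨x, hx⟩).symm.trans ((congrArg (fun t : T => (t : V)) h).trans (hφ ⟨y, hy⟩)))

end Components

end ConflictFree

/-! ### The theorem -/

open ConflictFree in
/-- A finite connected simple graph of diameter `2` has `vcfc(G) = 2` and
`cfc(G) = max {2, h(G)}`. -/
theorem mainTheorem4 {V : Type*} [Finite V] (G : SimpleGraph V)
    (hconn : G.Connected) (hdiam : G.diam = 2) :
    ConflictFree.vcfc G = 2 ∧
      ConflictFree.cfc G = max 2 (ConflictFree.maxCutForestCfc G) := by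
  classical
  have := hconn.nonempty
  have htop : G.ediam ≠ ⊤ := SimpleGraph.ediam_ne_top_of_diam_ne_zero (by omega)
  obtain ⟨u, v, huv⟩ := G.exists_dist_eq_diam
  have hne : u ≠ v := by rintro rfl; simp [hdiam] at huv
  have hnadj : ¬ G.Adj u v := fun h => by
    rw [SimpleGraph.dist_eq_one_iff_adj.2 h] at huv; omega
  have hd : ∀ x y, x ≠ y → ¬ G.Adj x y → ∃ m, G.Adj x m ∧ G.Adj m y := by
    intro x y hxy h
    obtain ⟨p, hp⟩ := hconn.exists_walk_length_eq_dist x y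
    have hle : p.length ≤ 2 := hp ▸ hdiam ▸ SimpleGraph.dist_le_diam htop
    match p, hle with
    | .nil, _ => exact absurd rfl hxy
    | .cons h₁ .nil, _ => exact absurd h₁ h
    | .cons h₁ (.cons h₂ .nil), _ => exact ⟨_, h₁, h₂⟩
  have hcut : (∀ w, ¬ ∀ x, x ≠ w → G.Adj w x) →
      ∀ a x y, x ≠ a → y ≠ a → (G.deleteIncidenceSet a).Reachable x y :=
    fun h a x y hx hy => reachable_deleteIncidenceSet hd (h a) hx hy
  constructor
  · apply le_antisymm
    · obtain ⟨a, ha⟩ : ∃ a, ∀ x y, x ≠ y → ∃ p : G.Walk x y, p.IsPath ∧ a ∈ p.support := by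
        by_cases hw : ∃ w, ∀ x, x ≠ w → G.Adj w x
        · obtain ⟨w, hw⟩ := hw
          exact ⟨w, fun x y hxy => exists_isPath_mem_support_of_forall_adj hw hxy⟩
        · exact ⟨u, fun x y hxy =>
            exists_isPath_mem_support hd (hcut (not_exists.1 hw)) hconn u hxy⟩
      exact Nat.sInf_le ⟨_, isVertexConflictFreeConnected_of_forall_mem
        (zero_ne_one : (0 : Fin 2) ≠ 1) a ha⟩
    · obtain ⟨c, hc⟩ := exists_vcfc_coloring hconn
      exact Fin.nontrivial_iff_two_le.1 (nontrivial_of_isVertexConflictFreeConnected hc hne)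
  · apply le_antisymm
    · let o : Fin (max 2 (maxCutForestCfc G)) := ⟨0, by omega⟩
      let i : Fin (max 2 (maxCutForestCfc G)) := ⟨1, by omega⟩
      have hoi : o ≠ i := by simp [o, i]
      refine Nat.sInf_le ?_
      by_cases hw : ∃ w, ∀ x, x ≠ w → G.Adj w x
      · obtain ⟨w, hw⟩ := hw
        obtain ⟨g, hg⟩ := exists_injOn_pendant hw (le_max_right 2 _) o
        exact exists_isEdgeConflictFreeConnected_of_forall_adj hoi hw hg
      -- Any edge would do here.
      · obtain ⟨m, hum, -⟩ := hd u v hne hnadj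
        exact exists_isEdgeConflictFreeConnected_of_forall_mem hoi hum fun x y hxy =>
          exists_isPath_mem_edges_of_adj hd (hcut (not_exists.1 hw)) hum hxy
    · refine max_le ?_ (maxCutForestCfc_le_cfc hconn)
      obtain ⟨c, hc⟩ := exists_cfc_coloring hconn
      exact Fin.nontrivial_iff_two_le.1 (nontrivial_of_isEdgeConflictFreeConnected hc hne hnadj)
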